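/- Let $m,n\ge 1$, and let $[m]$ and $[n]$ be disjoint ground sets with $m$ and $n$ elements. A simplicial complex on a finite set $V$ is a family of subsets of $V$ closed under taking subsets, and its Alexander dual is $\Delta^*=\{S\subseteq V: V\setminus S\notin\Delta\}$. Let $D_{m,n}$ be the Alexander dual of $2^{[m]}\sqcup 2^{[n]}$, so that $D_{m,n}=\{A\sqcup B: A\subsetneq[m],\ B\subsetneq[n]\}$, and let $\overline{D}_{m,n}$ be the set of its nonempty faces. For $S\subseteq[m]\sqcup[n]$ let $\mathbf d^S\in\mathbb R^{\overline D_{m,n}}$ be the vector with $d^S_F=1$ if $\#(F\cap S)$ is odd and $d^S_F=0$ if it is even, and let $\mathrm{GCut}(D_{m,n})$ be the convex hull of all $\mathbf d^S$. A facet is a maximal proper face (faces of a polytope include the empty face), and the co-facet of a facet $F$ is the set $\{S:\mathbf d^S\notin F\}$. Let $G_2^{m,n}$ be the complete bipartite graph between the subsets $A$ of $[m]$ and the subsets $B$ of $[n]$, directed $A\to B$ if $\#A+\#B$ is even and $B\to A$ if it is odd; the edge joining $A$ and $B$ is labelled by the set $A\sqcup B$, and a directed cycle (without repeated nodes) is identified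 with the set of labels of its edges. 1. The map that sends a facet to its co-facet is a bijection from the facets of $\mathrm{GCut}(D_{m,n})$ onto the directed cycles of $G_2^{m,n}$. 2. For a directed cycle $C$, among the inequalities $\mathbf q\cdot\mathbf x\le c$ that define the facet with co-facet $C$ there is exactly one that is normalized so that $\mathbf q\cdot\mathbf d^S=c-2^{m+n-3}$ for some $S$. For this one $c\in\{0,2^{m+n-3}\}$, and for every $S\subseteq[m]\sqcup[n]$ the value $\mathbf q\cdot\mathbf d^S$ is $c$ or $c-2^{m+n-3}$. We call it the facet inequality of $C$. 3. Let $C_1$ and $C_2$ be directed cycles without a common node, with edges $A_1\to B_1$ in $C_1$ and $A_2\to B_2$ in $C_2$ such that $\#A_1,\#B_1,\#A_2,\#B_2$ have the same parity and $\emptyset$ is none of the four sets $A_i\sqcup B_j$. Let $\mathbf q_1\cdot\mathbf x\le c_1$ be the facet inequality of $C_1$, and suppose that the facet inequality of $C_2$ is homogeneous, $\mathbf q_2\cdot\mathbf x\le 0$. Let $$C=\bigl(C_1\cup C_2\cup\{A_1\sqcup B_2,\ A_2\sqcup B_1\}\bigr)\setminus\{A_1\sqcup B_1,\ A_2\sqcup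 B_2\}$$ be obtained by gluing. Then $C$ is a directed cycle of $G_2^{m,n}$, and its facet inequality is $$\mathbf q_1\cdot\mathbf x+\mathbf q_2\cdot\mathbf x+\mathbf a\cdot\mathbf x\le c_1,$$ where $$\mathbf a\cdot\mathbf x=\sum_{(1,0,0,1)}x_S+\sum_{(0,1,1,0)}x_S-\sum_{(1,1,0,0)}x_S-\sum_{(0,0,1,1)}x_S,$$ and $\sum_{(\alpha,\beta,\gamma,\delta)}$ denotes the sum over all $S\in\overline D_{m,n}$ for which $\#(S\cap A_1),\#(S\cap B_1),\#(S\cap A_2),\#(S\cap B_2)$ are congruent modulo $2$ to $\alpha,\beta,\gamma,\delta$ respectively. In particular $c_1\in\{0,2^{m+n-3}\}$, and this functional takes the value $c_1$ or $c_1-2^{m+n-3}$ at every $\mathbf d^S$. -/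

import Mathlib

/-! Simplicial complexes on a finite ground set `V`: families of subsets of `V` closed under taking
subsets (the empty set counts as a face), that is, lower sets of `Finset V`. -/

/-- The disjoint union `Δ ⊔ Γ` of simplicial complexes on disjoint ground sets. -/
def disjointUnion {V W : Type*} (Δ : LowerSet (Finset V)) (Γ : LowerSet (Finset W)) :
    LowerSet (Finset (V ⊕ W)) where
  carrier := {S | (S.toLeft ∈ Δ ∧ S.toRight = ∅) ∨ (S.toLeft = ∅ ∧ S.toRight ∈ Γ)}
  lower' := by
    intro S T hTS hS
    have hl : T.toLeft ≤ S.toLeft := Finset.toLeft_monotone hTS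
    have hr : T.toRight ≤ S.toRight := Finset.toRight_monotone hTS
    rcases hS with ⟨h1, h2⟩ | ⟨h1, h2⟩
    · rw [h2] at hr
      exact Or.inl ⟨Δ.lower hl h1, Finset.subset_empty.mp hr⟩
    · rw [h1] at hl
      exact Or.inr ⟨Finset.subset_empty.mp hl, Γ.lower hr h2⟩

/-- The Alexander dual `Δ^* = {S | V \ S ∉ Δ}`. -/
def alexanderDual {V : Type*} [Fintype V] [DecidableEq V] (Δ : LowerSet (Finset V)) :
    LowerSet (Finset V) where
  carrier := {S | Sᶜ ∉ Δ}
  lower' := by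
    intro S T hTS hS hT
    exact hS (Δ.lower (Finset.compl_subset_compl.mpr hTS) hT)

/-- `D_{m,n}`, the Alexander dual of the disjoint union `2^{[m]} ⊔ 2^{[n]}` of two simplices. -/
def dualComplex (m n : ℕ) : LowerSet (Finset (Fin m ⊕ Fin n)) :=
  alexanderDual (disjointUnion (⊤ : LowerSet (Finset (Fin m))) (⊤ : LowerSet (Finset (Fin n))))

/-- The nonempty faces of `Δ`; they index the coordinates. -/
abbrev NonemptyFace {V : Type*} (Δ : LowerSet (Finset V)) : Type _ :=
  {F : Finset V // F ∈ Δ ∧ F.Nonempty}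

noncomputable instance {V : Type*} [Finite V] (Δ : LowerSet (Finset V)) :
    Fintype (NonemptyFace Δ) :=
  Fintype.ofFinite _

/-- The vector `d^S`: its `F`-coordinate is `1` if `#(F ∩ S)` is odd and `0` if it is even. -/
def cutVector {V : Type*} [DecidableEq V] (Δ : LowerSet (Finset V)) (S : Finset V) :
    NonemptyFace Δ → ℝ :=
  fun F => if Odd (F.1 ∩ S).card then 1 else 0

/-- The generalized cut polytope `GCut(Δ)`. -/
def GCut {V : Type*} [DecidableEq V] (Δ : LowerSet (Finset V)) : Set (NonemptyFace Δ → ℝ) :=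
  convexHull ℝ (Set.range (cutVector Δ))

/-- A facet of a polytope `P`: an inclusion-maximal proper face. (A face is the empty set or the set
of maximizers in `P` of a linear functional.) -/
def IsFacet {E : Type*} [AddCommGroup E] [Module ℝ E] [TopologicalSpace E] (P F : Set E) : Prop :=
  Maximal (fun G : Set E => IsExposed ℝ P G ∧ G ≠ P) F

/-- The co-facet of `F`: the (labels of the) vertices `d^S` that do not lie on `F`. -/
def coFacet {V : Type*} [DecidableEq V] (Δ : LowerSet (Finset V)) (F : Set (NonemptyFace Δ → ℝ)) :
    Set (Finset V) :=
  {S | cutVector Δ S ∉ F}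

/-- `q · x ≤ c` is a facet-defining inequality of `GCut(Δ)` and the facet that it defines has
co-facet `C`. -/
def IsFacetInequality {V : Type*} [Finite V] [DecidableEq V] (Δ : LowerSet (Finset V))
    (C : Set (Finset V)) (q : NonemptyFace Δ → ℝ) (c : ℝ) : Prop :=
  (∀ x ∈ GCut Δ, q ⬝ᵥ x ≤ c) ∧
    IsFacet (GCut Δ) {x ∈ GCut Δ | q ⬝ᵥ x = c} ∧
      coFacet Δ {x ∈ GCut Δ | q ⬝ᵥ x = c} = C

/-- The number `2^{m+n-3}` (an integer power, as `m + n` may be `2`). -/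
noncomputable def facetWidth (m n : ℕ) : ℝ := (2 : ℝ) ^ ((m : ℤ) + (n : ℤ) - 3)

/-- `q · x ≤ c` is the facet-defining inequality of `GCut(D_{m,n})` with co-facet `C`. A
facet-defining inequality matters only up to a positive factor, and the factor is fixed by asking
that some vertex takes the value `c - 2^{m+n-3}`. -/
def IsNormalizedFacetInequality (m n : ℕ) (C : Set (Finset (Fin m ⊕ Fin n)))
    (q : NonemptyFace (dualComplex m n) → ℝ) (c : ℝ) : Prop :=
  IsFacetInequality (dualComplex m n) C q c ∧
    ∃ S, q ⬝ᵥ cutVector (dualComplex m n) S = c - facetWidth m n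

/-- The digraph `G_2^{m,n}`: the complete bipartite graph between the subsets of `[m]` and the
subsets of `[n]`, with `A → B` if `#A + #B` is even and `B → A` if `#A + #B` is odd. -/
def digraphG (m n : ℕ) : Digraph (Finset (Fin m) ⊕ Finset (Fin n)) where
  Adj u v :=
    match u, v with
    | Sum.inl A, Sum.inr B => Even (A.card + B.card)
    | Sum.inr B, Sum.inl A => Odd (A.card + B.card)
    | _, _ => False

/-- `C` is the edge set of a directed cycle `v 0 → v 1 → ⋯ → v k → v 0` of `G_2^{m,n}` without
repeated nodes (the index `i + 1` is taken modulo `k + 1`). The edge between `A ⊆ [m]` and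
`B ⊆ [n]` is recorded as the set `A ⊔ B`. -/
def IsDirectedCycle (m n : ℕ) (C : Set (Finset (Fin m ⊕ Fin n))) : Prop :=
  ∃ (k : ℕ) (v : Fin (k + 1) → Finset (Fin m) ⊕ Finset (Fin n)),
    Function.Injective v ∧
    (∀ i, (digraphG m n).Adj (v i) (v (i + 1))) ∧
    C = {S | ∃ i, (v i = Sum.inl S.toLeft ∧ v (i + 1) = Sum.inr S.toRight) ∨
      (v i = Sum.inr S.toRight ∧ v (i + 1) = Sum.inl S.toLeft)}

/-- Cycles without a common node. -/
def NodeDisjoint {m n : ℕ} (C₁ C₂ : Set (Finset (Fin m ⊕ Fin n))) : Prop :=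
  ∀ S ∈ C₁, ∀ T ∈ C₂, S.toLeft ≠ T.toLeft ∧ S.toRight ≠ T.toRight

/-- The result of gluing `C₁` and `C₂` along their edges `A₁ ⊔ B₁` and `A₂ ⊔ B₂`. -/
def glue {m n : ℕ} (C₁ C₂ : Set (Finset (Fin m ⊕ Fin n)))
    (A₁ A₂ : Finset (Fin m)) (B₁ B₂ : Finset (Fin n)) : Set (Finset (Fin m ⊕ Fin n)) :=
  (C₁ ∪ C₂ ∪ {A₁.disjSum B₂, A₂.disjSum B₁}) \ {A₁.disjSum B₁, A₂.disjSum B₂}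

/-- The coefficient vector of the linear functional `a` attached to `A₁, A₂, B₁, B₂`. -/
def gluingFunctional {m n : ℕ} (A₁ A₂ : Finset (Fin m)) (B₁ B₂ : Finset (Fin n)) :
    NonemptyFace (dualComplex m n) → ℝ :=
  fun S =>
    (if Odd (S.1.toLeft ∩ A₁).card ∧ Even (S.1.toRight ∩ B₁).card ∧
        Even (S.1.toLeft ∩ A₂).card ∧ Odd (S.1.toRight ∩ B₂).card then 1 else 0) +
    (if Even (S.1.toLeft ∩ A₁).card ∧ Odd (S.1.toRight ∩ B₁).card ∧
        Odd (S.1.toLeft ∩ A₂).card ∧ Even (S.1.toRight ∩ B₂).card then 1 else 0) -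
    (if Odd (S.1.toLeft ∩ A₁).card ∧ Odd (S.1.toRight ∩ B₁).card ∧
        Even (S.1.toLeft ∩ A₂).card ∧ Even (S.1.toRight ∩ B₂).card then 1 else 0) -
    (if Even (S.1.toLeft ∩ A₁).card ∧ Even (S.1.toRight ∩ B₁).card ∧
        Odd (S.1.toLeft ∩ A₂).card ∧ Odd (S.1.toRight ∩ B₂).card then 1 else 0)

/-! ### Circulations and directed cycles in a finite multidigraph -/

/-! Record an inequality `q · x ≤ c` by its slack `S ↦ c - q · d^S`, a function on the subsets of
`[m] ⊔ [n]`, that is, on the edges of `G_2^{m,n}`. As `d^S_F = (1 - χ_F(S)) / 2` with `χ_F(S) =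
(-1)^{#(F ∩ S)}`, the slacks are the combinations of the `χ_F` with `F ∈ D_{m,n}`, where `F = ∅`
supplies the constants. A set outside `D_{m,n}` contains `[m]` or `[n]`, and the vanishing of all
Fourier coefficients at such sets is conservation of flow at the nodes (`isCirculation_slack`,
`IsCirculation.setFourier_eq_zero`).

So valid inequalities are nonnegative circulations. The co-facet of a face is the support of its
slack, hence facets correspond to minimal nonempty supports. These are the directed cycles: a
nonzero nonnegative circulation has a cycle in its support (`IsCirculation.exists_isEdgeCycle`), and
a circulation supported on a cycle is constant on it (`IsCirculation.eq_indicator`).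

Fourier inversion recovers `q` from the slack, and `c` is the slack at `∅`. The normalized
inequality of `C` is therefore the one with slack `2^{m+n-3} · 1_C`. Gluing alters `1_{C₁} + 1_{C₂}`
at four edges only, and the Fourier transform of this change is `a` (`slackCoeff_cross`). -/

/-- A function on the edges is a circulation if inflow and outflow agree at every node. -/
def IsCirculation {E N : Type*} [Fintype E] [DecidableEq N] (src tgt : E → N) (f : E → ℝ) : Prop :=
  ∀ x, ∑ e with tgt e = x, f e = ∑ e with src e = x, f e

/-- The edge sets of directed cycles without repeated nodes. -/
def IsEdgeCycle {E N : Type*} (src tgt : E → N) (C : Set E) : Prop :=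
  ∃ (k : ℕ) (e : Fin (k + 1) → E), Function.Injective (src ∘ e) ∧
    (∀ i, tgt (e i) = src (e (i + 1))) ∧ C = Set.range e

section Digraph

variable {E N : Type*} {src tgt : E → N}

theorem IsEdgeCycle.nonempty {C : Set E} (hC : IsEdgeCycle src tgt C) : C.Nonempty := by
  obtain ⟨k, e, -, -, rfl⟩ := hC
  exact Set.range_nonempty e

/-- A cycle can be traversed so that a given edge comes last. -/
theorem IsEdgeCycle.exists_last {C : Set E} (hC : IsEdgeCycle src tgt C) {a : E} (ha : a ∈ C) :
    ∃ (k : ℕ) (e : Fin (k + 1) → E), Function.Injective (src ∘ e) ∧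
      (∀ i, tgt (e i) = src (e (i + 1))) ∧ C = Set.range e ∧ e (Fin.last k) = a := by
  obtain ⟨k, e, hinj, hadj, rfl⟩ := hC
  obtain ⟨j, rfl⟩ := ha
  -- Rotate the numbering so that the last index lands on `j`.
  refine ⟨k, fun i => e (i + (j - Fin.last k)), ?_, ?_, ?_, ?_⟩
  · exact hinj.comp (add_left_injective _)
  · intro i
    rw [hadj]
    congr 2
    abel
  · exact ((Equiv.addRight (j - Fin.last k)).surjective.range_comp e).symm
  · simp

/-- An infinite walk in a finite graph contains a cycle. -/
theorem exists_isEdgeCycle_of_walk [Finite N] (w : ℕ → E)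
    (hw : ∀ i, tgt (w i) = src (w (i + 1))) :
    ∃ C, IsEdgeCycle src tgt C ∧ C ⊆ Set.range w := by
  classical
  have hex : ∃ p, ∃ a, src (w a) = src (w (a + p + 1)) := by
    obtain ⟨i, j, hij, h⟩ := Finite.exists_ne_map_eq_of_infinite (src ∘ w)
    rcases lt_or_gt_of_ne hij with hlt | hlt
    · exact ⟨j - i - 1, i, by rw [show i + (j - i - 1) + 1 = j by omega]; exact h⟩
    · exact ⟨i - j - 1, j, by rw [show j + (i - j - 1) + 1 = i by omega]; exact h.symm⟩
  obtain ⟨a, ha⟩ := Nat.find_spec hex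
  -- The shortest return time over all starting points is used, so no node repeats before the walk
  -- closes up.
  have hmin : ∀ q < Nat.find hex, ¬ ∃ a, src (w a) = src (w (a + q + 1)) :=
    fun q hq => Nat.find_min hex hq
  set p := Nat.find hex
  refine ⟨Set.range fun i : Fin (p + 1) => w (a + i), ⟨p, _, ?_, ?_, rfl⟩, ?_⟩
  · have key : ∀ i j : Fin (p + 1), i < j → src (w (a + i)) ≠ src (w (a + j)) := by
      intro i j hij h
      have hij' : (i : ℕ) < j := hij
      have hj := j.isLt
      refine hmin (j - i - 1) (by omega) ⟨a + i, ?_⟩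
      rw [h]
      congr 2
      omega
    intro i j h
    rcases lt_trichotomy i j with hij | hij | hij
    · exact absurd h (key i j hij)
    · exact hij
    · exact absurd h.symm (key j i hij)
  · intro i
    simp only [hw, Fin.val_add_one]
    split_ifs with hi
    · subst hi
      simpa using ha.symm
    · rfl
  · rintro _ ⟨i, rfl⟩
    exact ⟨_, rfl⟩

section Circulation

variable [Fintype E] [DecidableEq N]

open Classical in
theorem IsEdgeCycle.isCirculation {C : Set E} (hC : IsEdgeCycle src tgt C) (t : ℝ) :
    IsCirculation src tgt (C.indicator fun _ => t) := by
  obtain ⟨k, e, hinj, hadj, rfl⟩ := hC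
  have he : Function.Injective e := hinj.of_comp
  have key : ∀ g : E → N, ∀ x, ∑ a with g a = x, (Set.range e).indicator (fun _ => t) a =
      ∑ i, if g (e i) = x then t else 0 := by
    intro g x
    rw [Finset.sum_filter, ← Finset.sum_subset (Finset.subset_univ (Finset.univ.image e)),
      Finset.sum_image he.injOn]
    · simp
    · intro a _ ha
      have : a ∉ Set.range e := by simpa using ha
      simp [Set.indicator_of_notMem this]
  intro x
  rw [key, key]
  simp only [hadj]
  exact Equiv.sum_comp (Equiv.addRight (1 : Fin (k + 1)))
    (fun i => if src (e i) = x then t else 0)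

/-- At each node of the cycle exactly one edge of `C` enters and one leaves, so conservation carries
the value of `f` from each edge to the next. This gives both the minimality of cycles and the
uniqueness of the normalized inequality. -/
theorem IsCirculation.eq_indicator {C : Set E} (hC : IsEdgeCycle src tgt C) {f : E → ℝ}
    (hf : IsCirculation src tgt f) (hfC : Function.support f ⊆ C) :
    ∃ t, f = C.indicator fun _ => t := by
  obtain ⟨k, e, hinj, hadj, rfl⟩ := hC
  have htgt : Function.Injective (tgt ∘ e) := by
    have : tgt ∘ e = (src ∘ e) ∘ fun i => i + 1 := funext hadj
    rw [this]
    exact hinj.comp (add_left_injective 1)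
  have key : ∀ g : E → N, Function.Injective (g ∘ e) → ∀ i,
      ∑ a with g a = g (e i), f a = f (e i) := by
    intro g hg i
    refine Finset.sum_eq_single_of_mem _ (by simp) fun b hb hne => ?_
    by_contra hfb
    obtain ⟨j, rfl⟩ := hfC hfb
    exact hne (congrArg e (hg (by simpa using hb)))
  have hstep : ∀ i, f (e i) = f (e (i + 1)) := by
    intro i
    rw [← key tgt htgt i, ← key src hinj (i + 1), hf, hadj]
  have hconst : ∀ i, f (e i) = f (e 0) := by
    intro i
    induction i using Fin.induction with
    | zero => rfl
    | succ i ih =>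
      rw [← ih, hstep i.castSucc, Fin.coeSucc_eq_succ]
  refine ⟨f (e 0), funext fun a => ?_⟩
  by_cases ha : a ∈ Set.range e
  · obtain ⟨i, rfl⟩ := ha
    rw [Set.indicator_of_mem (Set.mem_range_self i), hconst]
  · rw [Set.indicator_of_notMem ha]
    by_contra hfa
    exact ha (hfC hfa)

/-- Positive flow into a node forces positive flow out of it, so a walk inside the support never
gets stuck and must eventually close up. -/
theorem IsCirculation.exists_isEdgeCycle [Finite N] {f : E → ℝ} (hf : IsCirculation src tgt f)
    (hf0 : 0 ≤ f) (hne : f ≠ 0) : ∃ C, IsEdgeCycle src tgt C ∧ C ⊆ Function.support f := by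
  have hnext : ∀ a : Function.support f, ∃ b : Function.support f, tgt a = src b := by
    rintro ⟨a, ha⟩
    have hpos : 0 < ∑ e with src e = tgt a, f e := by
      rw [← hf]
      exact Finset.sum_pos' (fun e _ => hf0 e) ⟨a, by simp, (hf0 a).lt_of_ne' ha⟩
    obtain ⟨b, hb, hfb⟩ := Finset.exists_ne_zero_of_sum_ne_zero hpos.ne'
    exact ⟨⟨b, hfb⟩, (Finset.mem_filter.mp hb).2.symm⟩
  choose next hnext using hnext
  obtain ⟨a, ha⟩ := Function.support_nonempty_iff.mpr hne
  obtain ⟨C, hC, hsub⟩ := exists_isEdgeCycle_of_walk (src := src) (tgt := tgt)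
    (fun i => ((next^[i] ⟨a, ha⟩ : Function.support f) : E)) (fun i => by
      rw [hnext, Function.iterate_succ_apply'])
  refine ⟨C, hC, hsub.trans ?_⟩
  rintro _ ⟨i, rfl⟩
  exact Subtype.coe_prop _

end Circulation

/-- Replacing the edges `a` and `b` of two disjoint cycles by edges that cross over joins them into
one cycle. -/
theorem IsEdgeCycle.join {C₁ C₂ : Set E} (h₁ : IsEdgeCycle src tgt C₁)
    (h₂ : IsEdgeCycle src tgt C₂) (hdisj : ∀ x ∈ C₁, ∀ y ∈ C₂, src x ≠ src y)
    {a b a' b' : E} (ha : a ∈ C₁) (hb : b ∈ C₂) (hsa : src a' = src a) (hta : tgt a' = tgt b)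
    (hsb : src b' = src b) (htb : tgt b' = tgt a) :
    IsEdgeCycle src tgt (insert a' (C₁ \ {a}) ∪ insert b' (C₂ \ {b})) := by
  classical
  obtain ⟨k, e, hinj, hadj, rfl, rfl⟩ := h₁.exists_last ha
  obtain ⟨l, d, hinj', hadj', rfl, rfl⟩ := h₂.exists_last hb
  have hrange : ∀ (j : ℕ) (g : Fin (j + 1) → E) (c : E), Function.Injective g →
      Set.range (Function.update g (Fin.last j) c) =
        insert c (Set.range g \ {g (Fin.last j)}) := by
    intro j g c hg
    ext x
    constructor
    · rintro ⟨i, rfl⟩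
      by_cases hi : i = Fin.last j
      · subst hi
        simp
      · rw [Function.update_of_ne hi]
        exact Or.inr ⟨⟨i, rfl⟩, fun h => hi (hg h)⟩
    · rintro (rfl | ⟨⟨i, rfl⟩, h⟩)
      · exact ⟨Fin.last j, by simp⟩
      · exact ⟨i, Function.update_of_ne (fun hi => h (by rw [hi]; rfl)) _ _⟩
  have hsrc₁ : ∀ i, src (Function.update e (Fin.last k) a' i) = src (e i) := by
    intro i
    by_cases hi : i = Fin.last k
    · subst hi; simpa using hsa
    · rw [Function.update_of_ne hi]
  have hsrc₂ : ∀ i, src (Function.update d (Fin.last l) b' i) = src (d i) := by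
    intro i
    by_cases hi : i = Fin.last l
    · subst hi; simpa using hsb
    · rw [Function.update_of_ne hi]
  -- The cyclic successor on the concatenated index set stays within a block, except that the last
  -- index of each block passes to the first index of the other.
  have hs₁ : ∀ i : Fin (k + 1), i ≠ Fin.last k →
      (Fin.castAdd (l + 1) i + 1 : Fin (k + 1 + l + 1)) = Fin.castAdd (l + 1) (i + 1) := by
    intro i hi
    have hlt : (i : ℕ) < k := Fin.val_lt_last hi
    ext
    rw [Fin.val_add_one, if_neg (by rw [Fin.ext_iff]; simp; omega)]
    simp [Fin.val_add_one, hi]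
  have hs₁' : (Fin.castAdd (l + 1) (Fin.last k) + 1 : Fin (k + 1 + l + 1)) =
      Fin.natAdd (k + 1) (0 : Fin (l + 1)) := by
    ext
    rw [Fin.val_add_one, if_neg (by rw [Fin.ext_iff]; simp; omega)]
    simp
  have hs₂ : ∀ i : Fin (l + 1), i ≠ Fin.last l →
      (Fin.natAdd (k + 1) i + 1 : Fin (k + 1 + l + 1)) = Fin.natAdd (k + 1) (i + 1) := by
    intro i hi
    have hlt : (i : ℕ) < l := Fin.val_lt_last hi
    ext
    rw [Fin.val_add_one, if_neg (by rw [Fin.ext_iff]; simp; omega)]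
    simp [Fin.val_add_one, hi, add_assoc]
  have hs₂' : (Fin.natAdd (k + 1) (Fin.last l) + 1 : Fin (k + 1 + l + 1)) =
      Fin.castAdd (l + 1) (0 : Fin (k + 1)) := by
    ext
    rw [Fin.val_add_one, if_pos (by rw [Fin.ext_iff]; simp)]
    simp
  refine ⟨k + 1 + l, Fin.append (m := k + 1) (n := l + 1) (Function.update e (Fin.last k) a')
    (Function.update d (Fin.last l) b'), ?_, ?_, ?_⟩
  · intro i j
    refine Fin.addCases (m := k + 1) (n := l + 1) (fun i => ?_) (fun i => ?_) i <;>
    refine Fin.addCases (m := k + 1) (n := l + 1) (fun j => ?_) (fun j => ?_) j <;>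
    simp only [Function.comp_apply, Fin.append_left, Fin.append_right, hsrc₁, hsrc₂]
    · exact fun h => congrArg _ (hinj h)
    · exact fun h => absurd h (hdisj _ ⟨i, rfl⟩ _ ⟨j, rfl⟩)
    · exact fun h => absurd h.symm (hdisj _ ⟨j, rfl⟩ _ ⟨i, rfl⟩)
    · exact fun h => congrArg _ (hinj' h)
  · intro i
    refine Fin.addCases (m := k + 1) (n := l + 1) (fun i => ?_) (fun i => ?_) i
    · by_cases hi : i = Fin.last k
      · subst hi
        rw [hs₁', Fin.append_left, Fin.append_right, hsrc₂, Function.update_self, hta, hadj',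
          Fin.last_add_one]
      · rw [hs₁ i hi, Fin.append_left, Fin.append_left, hsrc₁, Function.update_of_ne hi, hadj]
    · by_cases hi : i = Fin.last l
      · subst hi
        rw [hs₂', Fin.append_left, Fin.append_right, hsrc₁, Function.update_self, htb, hadj,
          Fin.last_add_one]
      · rw [hs₂ i hi, Fin.append_right, Fin.append_right, hsrc₂, Function.update_of_ne hi, hadj']
  · rw [← hrange k e a' hinj.of_comp, ← hrange l d b' hinj'.of_comp]
    ext x
    constructor
    · rintro (⟨i, rfl⟩ | ⟨i, rfl⟩)
      · exact ⟨Fin.castAdd (l + 1) i, by rw [Fin.append_left]⟩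
      · exact ⟨Fin.natAdd (k + 1) i, by rw [Fin.append_right]⟩
    · rintro ⟨i, rfl⟩
      refine Fin.addCases (m := k + 1) (n := l + 1) (fun i => ?_) (fun i => ?_) i
      · exact Or.inl ⟨i, by rw [Fin.append_left]⟩
      · exact Or.inr ⟨i, by rw [Fin.append_right]⟩

end Digraph

/-! ### Fourier analysis on the power set -/

open Finset in
/-- The character `S ↦ (-1)^{#(F ∩ S)}`. -/
noncomputable def setCharacter {V : Type*} [DecidableEq V] (F S : Finset V) : ℝ :=
  (-1) ^ #(F ∩ S)

section Character

variable {V : Type*} [DecidableEq V]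

theorem setCharacter_eq_ite (F S : Finset V) :
    setCharacter F S = if Odd (F ∩ S).card then -1 else 1 := by
  unfold setCharacter
  split_ifs with h
  · exact h.neg_one_pow
  · exact (Nat.not_odd_iff_even.mp h).neg_one_pow

theorem setCharacter_comm (F S : Finset V) : setCharacter F S = setCharacter S F := by
  unfold setCharacter
  rw [Finset.inter_comm]

theorem setCharacter_mul_self (F S : Finset V) : setCharacter F S * setCharacter F S = 1 := by
  unfold setCharacter
  rw [← mul_pow]
  simp

@[simp]
theorem setCharacter_empty_left (S : Finset V) : setCharacter ∅ S = 1 := by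
  simp [setCharacter]

@[simp]
theorem setCharacter_empty_right (S : Finset V) : setCharacter S ∅ = 1 := by
  simp [setCharacter]

theorem setCharacter_eq_prod (F S : Finset V) :
    setCharacter F S = ∏ v ∈ F, if v ∈ S then (-1 : ℝ) else 1 := by
  unfold setCharacter
  rw [Finset.prod_ite, Finset.filter_mem_eq_inter]
  simp

theorem setCharacter_symmDiff_singleton (F S : Finset V) (v : V) :
    setCharacter F (symmDiff S {v}) = setCharacter F S * if v ∈ F then -1 else 1 := by
  have h : ∀ w, (if w ∈ symmDiff S {v} then (-1 : ℝ) else 1) =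
      (if w ∈ S then -1 else 1) * if w = v then -1 else 1 := by
    intro w
    by_cases hw : w = v <;> by_cases hS : w ∈ S <;> simp_all [Finset.mem_symmDiff]
  rw [setCharacter_eq_prod, setCharacter_eq_prod, Finset.prod_congr rfl fun w _ => h w,
    Finset.prod_mul_distrib, Finset.prod_ite_eq']

theorem cutVector_apply (Δ : LowerSet (Finset V)) (S : Finset V) (F : NonemptyFace Δ) :
    cutVector Δ S F = (1 - setCharacter F.1 S) / 2 := by
  rw [setCharacter_eq_ite, cutVector]
  split_ifs <;> norm_num

variable [Fintype V]

/-- A function that is odd under toggling `v` sums to zero. -/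
theorem sum_eq_zero_of_symmDiff_singleton (v : V) {g : Finset V → ℝ}
    (hg : ∀ S, g (symmDiff S {v}) = -g S) : ∑ S, g S = 0 := by
  have h : ∑ S, g (symmDiff S {v}) = ∑ S, g S :=
    Equiv.sum_comp (symmDiff_left_involutive ({v} : Finset V)).toPerm g
  simp only [hg, Finset.sum_neg_distrib] at h
  linarith

/-- If `S ≠ T`, toggling in `F` an element that lies in only one of them flips the sign of the
product. -/
theorem sum_setCharacter_mul_setCharacter (S T : Finset V) :
    ∑ F, setCharacter F S * setCharacter F T = if S = T then 2 ^ Fintype.card V else 0 := by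
  split_ifs with h
  · subst h
    simp [setCharacter_mul_self, Finset.card_univ, Fintype.card_finset]
  · obtain ⟨v, hv⟩ : ∃ v, ¬ (v ∈ S ↔ v ∈ T) := by
      by_contra! hc
      exact h (Finset.ext hc)
    refine sum_eq_zero_of_symmDiff_singleton v fun F => ?_
    simp only [setCharacter_comm _ S, setCharacter_comm _ T, setCharacter_symmDiff_singleton]
    by_cases hS : v ∈ S <;> by_cases hT : v ∈ T <;> simp_all

/-- The Fourier coefficient of `f` at `F`. -/
noncomputable def setFourier (f : Finset V → ℝ) (F : Finset V) : ℝ :=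
  (∑ S, f S * setCharacter F S) / 2 ^ Fintype.card V

theorem sum_setFourier_mul_setCharacter (f : Finset V → ℝ) (S : Finset V) :
    ∑ F, setFourier f F * setCharacter F S = f S := by
  have h2 : (2 : ℝ) ^ Fintype.card V ≠ 0 := by positivity
  simp only [setFourier, div_mul_eq_mul_div, Finset.sum_mul, ← Finset.sum_div]
  rw [Finset.sum_comm, div_eq_iff h2]
  simp only [mul_assoc, ← Finset.mul_sum, sum_setCharacter_mul_setCharacter]
  simp

/-- The coefficient vector of the inequality whose slack is `f`. -/
noncomputable def slackCoeff (Δ : LowerSet (Finset V)) (f : Finset V → ℝ) : NonemptyFace Δ → ℝ :=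
  fun F => 2 * setFourier f F.1

/-- The slack of the inequality `q · x ≤ c` at the vertices. -/
noncomputable def slack (Δ : LowerSet (Finset V)) (q : NonemptyFace Δ → ℝ) (c : ℝ)
    (S : Finset V) : ℝ :=
  c - q ⬝ᵥ cutVector Δ S

theorem slack_empty (Δ : LowerSet (Finset V)) (q : NonemptyFace Δ → ℝ) (c : ℝ) :
    slack Δ q c ∅ = c := by
  have : cutVector Δ ∅ = 0 := by ext F; simp [cutVector]
  simp [slack, this]

/-- Fourier inversion writes `f` as a combination of characters of faces. The coefficient at `∅` is
no coordinate of `q`; it is absorbed in the constant `f ∅`, because `d^∅ = 0`. -/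
theorem slack_slackCoeff {Δ : LowerSet (Finset V)} (hΔ : ∅ ∈ Δ) {f : Finset V → ℝ}
    (hf : ∀ F ∉ Δ, setFourier f F = 0) : slack Δ (slackCoeff Δ f) (f ∅) = f := by
  classical
  have key : ∀ S, f S - setFourier f ∅ =
      ∑ F : NonemptyFace Δ, setFourier f F.1 * setCharacter F.1 S := by
    intro S
    rw [← Finset.sum_subtype (p := fun F => F ∈ Δ ∧ F.Nonempty)
      (Finset.univ.filter fun F : Finset V => F ∈ Δ ∧ F.Nonempty) (by simp)
      (fun F => setFourier f F * setCharacter F S), sub_eq_iff_eq_add']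
    have hsub := Finset.sum_subset (Finset.subset_univ
      (insert ∅ (Finset.univ.filter fun F : Finset V => F ∈ Δ ∧ F.Nonempty)))
      (f := fun F => setFourier f F * setCharacter F S) (by
        intro F _ hF
        rw [hf F, zero_mul]
        intro hFΔ
        rcases F.eq_empty_or_nonempty with h | h <;> simp_all)
    rw [sum_setFourier_mul_setCharacter, Finset.sum_insert (by simp)] at hsub
    simpa using hsub.symm
  funext S
  have hS := key S
  have h0 := key ∅
  simp only [setCharacter_empty_right, mul_one] at h0
  have : slackCoeff Δ f ⬝ᵥ cutVector Δ S =
      ∑ F : NonemptyFace Δ, setFourier f F.1 -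
        ∑ F : NonemptyFace Δ, setFourier f F.1 * setCharacter F.1 S := by
    rw [← Finset.sum_sub_distrib]
    refine Finset.sum_congr rfl fun F _ => ?_
    rw [cutVector_apply, slackCoeff]
    ring
  rw [slack, this, ← hS, ← h0]
  ring

theorem slackCoeff_slack (Δ : LowerSet (Finset V)) (q : NonemptyFace Δ → ℝ) (c : ℝ) :
    slackCoeff Δ (slack Δ q c) = q := by
  have h2 : (2 : ℝ) ^ Fintype.card V ≠ 0 := by positivity
  have horth : ∀ F G : Finset V, ∑ S, setCharacter F S * setCharacter G S =
      if F = G then 2 ^ Fintype.card V else 0 := by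
    intro F G
    simp only [setCharacter_comm F, setCharacter_comm G]
    exact sum_setCharacter_mul_setCharacter F G
  funext F
  have hF : ∑ S, setCharacter F.1 S = 0 := by
    have := horth F.1 ∅
    rw [if_neg F.2.2.ne_empty] at this
    simpa using this
  -- The factor `-1/2` of `χ_G` in the coordinate `d^S_G` is the source of the factor `2` in
  -- `slackCoeff`.
  have hcoeff : ∀ G : NonemptyFace Δ, ∑ S, cutVector Δ S G * setCharacter F.1 S =
      if F = G then -(2 ^ Fintype.card V / 2) else 0 := by
    intro G
    have : ∀ S, cutVector Δ S G * setCharacter F.1 S =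
        setCharacter F.1 S / 2 - setCharacter F.1 S * setCharacter G.1 S / 2 := by
      intro S
      rw [cutVector_apply]
      ring
    simp only [this, Finset.sum_sub_distrib, ← Finset.sum_div, horth, hF, Subtype.ext_iff]
    split_ifs <;> ring
  have hsum : ∑ S, slack Δ q c S * setCharacter F.1 S = q F * (2 ^ Fintype.card V / 2) := by
    simp only [slack, sub_mul, Finset.sum_sub_distrib, ← Finset.mul_sum, hF, dotProduct,
      Finset.sum_mul]
    rw [Finset.sum_comm]
    simp only [mul_assoc, ← Finset.mul_sum, hcoeff]
    simp
  rw [slackCoeff, setFourier, hsum]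
  field_simp

end Character

/-! ### The digraph `G_2^{m,n}` with edges given by their labels -/

section Label

variable {m n : ℕ}

/-- The node at which the edge with label `S` starts. -/
def edgeSrc (S : Finset (Fin m ⊕ Fin n)) : Finset (Fin m) ⊕ Finset (Fin n) :=
  if Even S.card then Sum.inl S.toLeft else Sum.inr S.toRight

/-- The node at which the edge with label `S` ends. -/
def edgeTgt (S : Finset (Fin m ⊕ Fin n)) : Finset (Fin m) ⊕ Finset (Fin n) :=
  if Even S.card then Sum.inr S.toRight else Sum.inl S.toLeft

theorem card_eq_card_toLeft_add (S : Finset (Fin m ⊕ Fin n)) :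
    S.card = S.toLeft.card + S.toRight.card :=
  Finset.card_toLeft_add_card_toRight.symm

theorem digraphG_adj_iff (u v : Finset (Fin m) ⊕ Finset (Fin n)) :
    (digraphG m n).Adj u v ↔ ∃ S, edgeSrc S = u ∧ edgeTgt S = v := by
  constructor
  · intro h
    rcases u with A | B <;> rcases v with A' | B'
    · exact h.elim
    · have h' : Even (A.card + B'.card) := h
      exact ⟨A.disjSum B', by simp [edgeSrc, h'], by simp [edgeTgt, h']⟩
    · have h' : ¬ Even (A'.card + B.card) := Nat.not_even_iff_odd.mpr h
      exact ⟨A'.disjSum B, by simp [edgeSrc, h'], by simp [edgeTgt, h']⟩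
    · exact h.elim
  · rintro ⟨S, rfl, rfl⟩
    unfold edgeSrc edgeTgt
    split_ifs with h
    · change Even (S.toLeft.card + S.toRight.card)
      rwa [← card_eq_card_toLeft_add]
    · exact Nat.not_even_iff_odd.mp ((card_eq_card_toLeft_add S) ▸ h)

/-- There are no parallel edges, so node sequences and edge sequences describe the same cycles. -/
theorem edge_ext {S T : Finset (Fin m ⊕ Fin n)} (hs : edgeSrc S = edgeSrc T)
    (ht : edgeTgt S = edgeTgt T) : S = T := by
  rw [← S.toLeft_disjSum_toRight, ← T.toLeft_disjSum_toRight]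
  unfold edgeSrc at hs
  unfold edgeTgt at ht
  split_ifs at hs ht <;> simp_all

theorem joins_iff {u v : Finset (Fin m) ⊕ Finset (Fin n)} (h : (digraphG m n).Adj u v)
    (S : Finset (Fin m ⊕ Fin n)) :
    (u = Sum.inl S.toLeft ∧ v = Sum.inr S.toRight ∨
      u = Sum.inr S.toRight ∧ v = Sum.inl S.toLeft) ↔ edgeSrc S = u ∧ edgeTgt S = v := by
  constructor
  · rintro (⟨rfl, rfl⟩ | ⟨rfl, rfl⟩)
    · have h' : Even S.card := (card_eq_card_toLeft_add S) ▸ h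
      simp [edgeSrc, edgeTgt, h']
    · have h' : ¬ Even S.card := Nat.not_even_iff_odd.mpr ((card_eq_card_toLeft_add S) ▸ h)
      simp [edgeSrc, edgeTgt, h']
  · rintro ⟨rfl, rfl⟩
    unfold edgeSrc edgeTgt
    split_ifs <;> simp

theorem isDirectedCycle_iff {C : Set (Finset (Fin m ⊕ Fin n))} :
    IsDirectedCycle m n C ↔ IsEdgeCycle edgeSrc edgeTgt C := by
  constructor
  · rintro ⟨k, v, hinj, hadj, rfl⟩
    have hex := fun i => (digraphG_adj_iff _ _).mp (hadj i)
    choose e hsrc htgt using hex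
    refine ⟨k, e, ?_, ?_, ?_⟩
    · rwa [show edgeSrc ∘ e = v from funext hsrc]
    · exact fun i => (htgt i).trans (hsrc (i + 1)).symm
    · ext S
      simp only [Set.mem_ofPred_eq, Set.mem_range]
      refine exists_congr fun i => (joins_iff (hadj i) S).trans ⟨?_, ?_⟩
      · rintro ⟨h1, h2⟩
        exact edge_ext ((hsrc i).trans h1.symm) ((htgt i).trans h2.symm)
      · rintro rfl
        exact ⟨hsrc i, htgt i⟩
  · rintro ⟨k, e, hinj, hadj, rfl⟩
    have hadj' : ∀ i, (digraphG m n).Adj ((edgeSrc ∘ e) i) ((edgeSrc ∘ e) (i + 1)) :=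
      fun i => (digraphG_adj_iff _ _).mpr ⟨e i, rfl, hadj i⟩
    refine ⟨k, edgeSrc ∘ e, hinj, hadj', ?_⟩
    ext S
    simp only [Set.mem_ofPred_eq, Set.mem_range]
    refine exists_congr fun i => Iff.symm ((joins_iff (hadj' i) S).trans ⟨?_, ?_⟩)
    · rintro ⟨h1, h2⟩
      exact edge_ext h1.symm ((hadj i).trans h2.symm)
    · rintro rfl
      exact ⟨rfl, hadj i⟩

theorem mem_dualComplex {F : Finset (Fin m ⊕ Fin n)} :
    F ∈ dualComplex m n ↔ (∃ a, Sum.inl a ∉ F) ∧ ∃ b, Sum.inr b ∉ F := by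
  change ¬ ((_ ∧ Fᶜ.toRight = ∅) ∨ (Fᶜ.toLeft = ∅ ∧ _)) ↔ _
  simp only [LowerSet.mem_top, true_and, and_true, Finset.eq_empty_iff_forall_notMem,
    Finset.mem_toLeft, Finset.mem_toRight, Finset.mem_compl, not_or, not_forall, not_not]
  exact and_comm

theorem empty_mem_dualComplex (hm : 1 ≤ m) (hn : 1 ≤ n) : ∅ ∈ dualComplex m n :=
  mem_dualComplex.mpr ⟨⟨⟨0, hm⟩, by simp⟩, ⟨⟨0, hn⟩, by simp⟩⟩

/-- Alternating sums of a circulation over the edges at a node vanish. -/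
theorem isCirculation_edge_iff {f : Finset (Fin m ⊕ Fin n) → ℝ} :
    IsCirculation edgeSrc edgeTgt f ↔
      (∀ A, ∑ S with S.toLeft = A, (-1) ^ S.card * f S = 0) ∧
        ∀ B, ∑ S with S.toRight = B, (-1) ^ S.card * f S = 0 := by
  have hl : ∀ A, ∑ S with S.toLeft = A, (-1) ^ S.card * f S =
      ∑ S with edgeSrc S = Sum.inl A, f S - ∑ S with edgeTgt S = Sum.inl A, f S := by
    intro A
    simp only [Finset.sum_filter]
    rw [← Finset.sum_sub_distrib]
    refine Finset.sum_congr rfl fun S _ => ?_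
    rcases Nat.even_or_odd S.card with h | h
    · simp [edgeSrc, edgeTgt, h]
    · simp [edgeSrc, edgeTgt, h, Nat.not_even_iff_odd.mpr h]
      split_ifs <;> simp
  have hr : ∀ B, ∑ S with S.toRight = B, (-1) ^ S.card * f S =
      ∑ S with edgeTgt S = Sum.inr B, f S - ∑ S with edgeSrc S = Sum.inr B, f S := by
    intro B
    simp only [Finset.sum_filter]
    rw [← Finset.sum_sub_distrib]
    refine Finset.sum_congr rfl fun S _ => ?_
    rcases Nat.even_or_odd S.card with h | h
    · simp [edgeSrc, edgeTgt, h]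
    · simp [edgeSrc, edgeTgt, h, Nat.not_even_iff_odd.mpr h]
      split_ifs <;> simp
  simp only [IsCirculation, Sum.forall, hl, hr, sub_eq_zero]
  refine and_congr_left' (forall_congr' fun A => eq_comm)

/-- By linearity it suffices to treat the characters of faces, including the constant one. A face
misses some `b ∈ [n]`; toggling `b` preserves the left part of an edge and the character but flips
`(-1)^{#S}`, so the alternating sum at a node `A ⊆ [m]` cancels in pairs. Nodes on the other side
use a missing `a ∈ [m]`. -/
theorem isCirculation_slack (q : NonemptyFace (dualComplex m n) → ℝ) (c : ℝ) (hm : 1 ≤ m)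
    (hn : 1 ≤ n) : IsCirculation edgeSrc edgeTgt (slack (dualComplex m n) q c) := by
  have hcard : ∀ (S : Finset (Fin m ⊕ Fin n)) (v : Fin m ⊕ Fin n),
      (-1 : ℝ) ^ (symmDiff S {v}).card = -(-1) ^ S.card := by
    intro S v
    have h := setCharacter_symmDiff_singleton Finset.univ S v
    simpa [setCharacter] using h
  have hchar : ∀ F : Finset (Fin m ⊕ Fin n), ∀ v ∉ F, ∀ p : Finset (Fin m ⊕ Fin n) → Prop,
      (∀ S, p (symmDiff S {v}) ↔ p S) → ∀ [DecidablePred p],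
      ∑ S with p S, (-1) ^ S.card * setCharacter F S = 0 := by
    intro F v hv p hp _
    rw [Finset.sum_filter]
    refine sum_eq_zero_of_symmDiff_singleton v fun S => ?_
    simp only [hp, hcard, setCharacter_symmDiff_singleton, if_neg hv]
    split_ifs <;> ring
  have hleft : ∀ (A : Finset (Fin m)) (b : Fin n) (S : Finset (Fin m ⊕ Fin n)),
      (symmDiff S {Sum.inr b}).toLeft = A ↔ S.toLeft = A := by
    intro A b S
    rw [show (symmDiff S {Sum.inr b}).toLeft = S.toLeft by ext; simp [Finset.mem_symmDiff]]
  have hright : ∀ (B : Finset (Fin n)) (a : Fin m) (S : Finset (Fin m ⊕ Fin n)),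
      (symmDiff S {Sum.inl a}).toRight = B ↔ S.toRight = B := by
    intro B a S
    rw [show (symmDiff S {Sum.inl a}).toRight = S.toRight by ext; simp [Finset.mem_symmDiff]]
  have hp : ∀ p : Finset (Fin m ⊕ Fin n) → Prop, ∀ [DecidablePred p],
      (∀ F ∈ dualComplex m n, ∑ S with p S, (-1) ^ S.card * setCharacter F S = 0) →
      ∑ S with p S, (-1) ^ S.card * slack (dualComplex m n) q c S = 0 := by
    intro p _ h
    -- Constants are the case `F = ∅`, which is a face because `m, n ≥ 1`.
    have h0 : ∑ S with p S, (-1 : ℝ) ^ S.card = 0 := by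
      simpa using h ∅ (empty_mem_dualComplex hm hn)
    have hF : ∀ F : NonemptyFace (dualComplex m n),
        ∑ S with p S, (-1) ^ S.card * cutVector (dualComplex m n) S F = 0 := by
      intro F
      have : ∀ S, (-1) ^ S.card * cutVector (dualComplex m n) S F =
          (-1) ^ S.card / 2 - (-1) ^ S.card * setCharacter F.1 S / 2 := by
        intro S
        rw [cutVector_apply]
        ring
      simp only [this, Finset.sum_sub_distrib, ← Finset.sum_div, h0, h F.1 F.2.1]
      ring
    simp only [slack, mul_sub, Finset.sum_sub_distrib, ← Finset.sum_mul, h0, dotProduct,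
      Finset.mul_sum]
    rw [Finset.sum_comm]
    simp only [mul_left_comm _ (q _), ← Finset.mul_sum, hF]
    simp
  refine isCirculation_edge_iff.mpr ⟨fun A => hp _ fun F hF => ?_, fun B => hp _ fun F hF => ?_⟩
  · obtain ⟨-, b, hb⟩ := mem_dualComplex.mp hF
    exact hchar F _ hb _ (hleft A b)
  · obtain ⟨⟨a, ha⟩, -⟩ := mem_dualComplex.mp hF
    exact hchar F _ ha _ (hright B a)

theorem setCharacter_eq_mul (F S : Finset (Fin m ⊕ Fin n)) :
    setCharacter F S = setCharacter F.toLeft S.toLeft * setCharacter F.toRight S.toRight := by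
  unfold setCharacter
  rw [← pow_add, card_eq_card_toLeft_add, Finset.toLeft_inter, Finset.toRight_inter]

/-- If `F ⊇ [m]`, then on the edges at a fixed node `B` the character `χ_F` equals `(-1)^{#S}` up to
a constant sign, so each fibre of the Fourier sum is a multiple of the alternating sum at `B`. The
case `F ⊇ [n]` is symmetric. -/
theorem IsCirculation.setFourier_eq_zero {f : Finset (Fin m ⊕ Fin n) → ℝ}
    (hf : IsCirculation edgeSrc edgeTgt f) {F : Finset (Fin m ⊕ Fin n)}
    (hF : F ∉ dualComplex m n) : setFourier f F = 0 := by
  obtain ⟨hl, hr⟩ := isCirculation_edge_iff.mp hf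
  have hsign : ∀ S : Finset (Fin m ⊕ Fin n),
      (-1 : ℝ) ^ S.card = (-1) ^ S.toLeft.card * (-1) ^ S.toRight.card := by
    intro S
    rw [← pow_add, card_eq_card_toLeft_add]
  have hsq : ∀ k : ℕ, (-1 : ℝ) ^ k * (-1) ^ k = 1 := by
    intro k
    rw [← mul_pow]
    simp
  rw [mem_dualComplex, not_and_or] at hF
  rw [setFourier, div_eq_zero_iff]
  left
  rcases hF with hF | hF
  · have hF' : F.toLeft = Finset.univ := by
      ext a
      simpa using not_not.mp (not_exists.mp hF a)
    rw [← Finset.sum_fiberwise _ Finset.toRight]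
    refine Finset.sum_eq_zero fun B _ => ?_
    rw [← mul_zero ((-1) ^ B.card * setCharacter F.toRight B), ← hr B, Finset.mul_sum]
    refine Finset.sum_congr rfl fun S hS => ?_
    obtain rfl := (Finset.mem_filter.mp hS).2
    rw [setCharacter_eq_mul, hF', setCharacter, Finset.univ_inter, hsign]
    linear_combination (-(f S) * (-1) ^ S.toLeft.card * setCharacter F.toRight S.toRight) *
      hsq S.toRight.card
  · have hF' : F.toRight = Finset.univ := by
      ext a
      simpa using not_not.mp (not_exists.mp hF a)
    rw [← Finset.sum_fiberwise _ Finset.toLeft]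
    refine Finset.sum_eq_zero fun A _ => ?_
    rw [← mul_zero ((-1) ^ A.card * setCharacter F.toLeft A), ← hl A, Finset.mul_sum]
    refine Finset.sum_congr rfl fun S hS => ?_
    obtain rfl := (Finset.mem_filter.mp hS).2
    rw [setCharacter_eq_mul, hF', setCharacter.eq_def Finset.univ, Finset.univ_inter, hsign]
    linear_combination (-(f S) * (-1) ^ S.toRight.card * setCharacter F.toLeft S.toLeft) *
      hsq S.toLeft.card

theorem IsCirculation.slack_slackCoeff (hm : 1 ≤ m) (hn : 1 ≤ n)
    {f : Finset (Fin m ⊕ Fin n) → ℝ} (hf : IsCirculation edgeSrc edgeTgt f) :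
    slack (dualComplex m n) (slackCoeff (dualComplex m n) f) (f ∅) = f :=
  _root_.slack_slackCoeff (empty_mem_dualComplex hm hn) fun _ => hf.setFourier_eq_zero

end Label

/-! ### Faces of `GCut` and their slacks -/

section Face

variable {V : Type*} [DecidableEq V] {Δ : LowerSet (Finset V)}

theorem cutVector_mem_GCut (S : Finset V) : cutVector Δ S ∈ GCut Δ :=
  subset_convexHull ℝ _ ⟨S, rfl⟩

theorem coFacet_anti {F G : Set (NonemptyFace Δ → ℝ)} (h : F ⊆ G) : coFacet Δ G ⊆ coFacet Δ F :=
  fun _ hS hF => hS (h hF)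

variable [Fintype V]

theorem dotProduct_le_of_slack_nonneg {q : NonemptyFace Δ → ℝ} {c : ℝ} (h : 0 ≤ slack Δ q c)
    {x : NonemptyFace Δ → ℝ} (hx : x ∈ GCut Δ) : q ⬝ᵥ x ≤ c := by
  have hlin : IsLinearMap ℝ fun x : NonemptyFace Δ → ℝ => q ⬝ᵥ x :=
    ⟨fun x y => dotProduct_add q x y, fun a x => dotProduct_smul a q x⟩
  refine convexHull_min ?_ (convex_halfSpace_le hlin c) hx
  rintro _ ⟨S, rfl⟩
  exact sub_nonneg.mp (h S)

theorem slack_nonneg_of_forall {q : NonemptyFace Δ → ℝ} {c : ℝ} (h : ∀ x ∈ GCut Δ, q ⬝ᵥ x ≤ c) :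
    0 ≤ slack Δ q c :=
  fun S => sub_nonneg.mpr (h _ (cutVector_mem_GCut S))

/-- The face on which `q · x ≤ c` is tight. -/
def tightFace (Δ : LowerSet (Finset V)) (q : NonemptyFace Δ → ℝ) (c : ℝ) :
    Set (NonemptyFace Δ → ℝ) :=
  {x ∈ GCut Δ | q ⬝ᵥ x = c}

theorem coFacet_tightFace (q : NonemptyFace Δ → ℝ) (c : ℝ) :
    coFacet Δ (tightFace Δ q c) = Function.support (slack Δ q c) := by
  ext S
  have : cutVector Δ S ∈ tightFace Δ q c ↔ slack Δ q c S = 0 := by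
    rw [slack, sub_eq_zero, eq_comm]
    exact and_iff_right (cutVector_mem_GCut S)
  exact not_congr this

/-- A face is determined by the vertices on it. -/
theorem tightFace_subset {q q' : NonemptyFace Δ → ℝ} {c c' : ℝ} (h : 0 ≤ slack Δ q c)
    (h' : 0 ≤ slack Δ q' c')
    (hsub : Function.support (slack Δ q' c') ⊆ Function.support (slack Δ q c)) :
    tightFace Δ q c ⊆ tightFace Δ q' c' := by
  -- With finitely many vertices and nested supports, some multiple of the first slack dominates the
  -- second. Then `K q - q'` also gives a valid inequality, which on the first face forces `q' · x ≥
  -- c'`.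
  obtain ⟨K, hK⟩ : ∃ K : ℝ, ∀ S, slack Δ q' c' S ≤ K * slack Δ q c S := by
    obtain ⟨K, hK⟩ := Finite.exists_le fun S => slack Δ q' c' S / slack Δ q c S
    refine ⟨K, fun S => ?_⟩
    by_cases hS : slack Δ q c S = 0
    · have : slack Δ q' c' S = 0 := by
        by_contra hne
        exact hsub hne hS
      simp [hS, this]
    · exact (div_le_iff₀ ((h S).lt_of_ne' hS)).mp (hK S)
  rintro x ⟨hx, hxc⟩
  refine ⟨hx, (dotProduct_le_of_slack_nonneg h' hx).antisymm ?_⟩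
  have key : (K • q - q') ⬝ᵥ x ≤ K * c - c' := by
    refine dotProduct_le_of_slack_nonneg (fun S => ?_) hx
    have := hK S
    simp only [slack, sub_dotProduct, smul_dotProduct, smul_eq_mul, Pi.zero_apply] at this ⊢
    linarith
  rw [sub_dotProduct, smul_dotProduct, hxc, smul_eq_mul] at key
  linarith

theorem tightFace_ne_iff {q : NonemptyFace Δ → ℝ} {c : ℝ} :
    tightFace Δ q c ≠ GCut Δ ↔ slack Δ q c ≠ 0 := by
  refine not_congr ⟨fun h => funext fun S => ?_, fun h => ?_⟩
  · have := h.symm ▸ cutVector_mem_GCut (Δ := Δ) S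
    simp [slack, this.2]
  · refine Set.Subset.antisymm (fun x hx => hx.1) fun x hx => ⟨hx, ?_⟩
    refine (dotProduct_le_of_slack_nonneg h.ge hx).antisymm ?_
    -- When the slack vanishes, the reversed inequality is valid too, so equality holds on the whole
    -- polytope.
    have h0 : 0 ≤ slack Δ (-q) (-c) := fun S => by
      have := congrFun h S
      simp only [slack, neg_dotProduct, Pi.zero_apply] at this ⊢
      linarith
    have := dotProduct_le_of_slack_nonneg h0 hx
    rw [neg_dotProduct] at this
    linarith

theorem isExposed_tightFace {q : NonemptyFace Δ → ℝ} {c : ℝ} (h : 0 ≤ slack Δ q c) :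
    IsExposed ℝ (GCut Δ) (tightFace Δ q c) := by
  rintro ⟨x₀, hx₀, hqx₀⟩
  refine ⟨LinearMap.toContinuousLinearMap (dotProductBilin ℝ ℝ q), ?_⟩
  ext x
  refine and_congr_right fun hx => ⟨fun hqx y hy => ?_, fun hmax => ?_⟩
  · change q ⬝ᵥ y ≤ q ⬝ᵥ x
    rw [hqx]
    exact dotProduct_le_of_slack_nonneg h hy
  · exact (dotProduct_le_of_slack_nonneg h hx).antisymm (hqx₀ ▸ hmax x₀ hx₀)

theorem exists_tightFace_eq {F : Set (NonemptyFace Δ → ℝ)} (hF : IsExposed ℝ (GCut Δ) F) :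
    ∃ q c, 0 ≤ slack Δ q c ∧ F = tightFace Δ q c := by
  rcases F.eq_empty_or_nonempty with rfl | hne
  · refine ⟨0, 1, fun S => by simp [slack], ?_⟩
    simp [tightFace]
  · obtain ⟨l, hl⟩ := hF hne
    obtain ⟨x₀, hx₀⟩ := hne
    have hdot : ∀ x, l x = (fun i => l (Pi.single i 1)) ⬝ᵥ x := by
      intro x
      have hx : x = ∑ i, x i • Pi.single i (1 : ℝ) := by
        simpa using pi_eq_sum_univ' x
      conv_lhs => rw [hx]
      simp [dotProduct, mul_comm]
    have hle : ∀ y ∈ GCut Δ, l y ≤ l x₀ := (hl ▸ hx₀).2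
    refine ⟨_, l x₀, slack_nonneg_of_forall fun x hx => (hdot x).symm.trans_le (hle x hx), ?_⟩
    ext x
    rw [hl]
    refine and_congr_right fun hx => ?_
    rw [← hdot]
    exact ⟨fun h => (hle x hx).antisymm (h x₀ (hl ▸ hx₀).1), fun h y hy => h ▸ hle y hy⟩

end Face

/-! ### Facets as directed cycles, and the normalized inequality -/

section Facet

variable {m n : ℕ}

theorem isFacet_tightFace_iff (hm : 1 ≤ m) (hn : 1 ≤ n)
    {q : NonemptyFace (dualComplex m n) → ℝ} {c : ℝ} (h : 0 ≤ slack (dualComplex m n) q c) :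
    IsFacet (GCut (dualComplex m n)) (tightFace (dualComplex m n) q c) ↔
      IsDirectedCycle m n (Function.support (slack (dualComplex m n) q c)) := by
  rw [isDirectedCycle_iff]
  constructor
  · rintro ⟨⟨-, hproper⟩, hmax⟩
    -- A cycle in the support of the slack yields a proper face containing the given one; maximality
    -- makes the two supports equal.
    obtain ⟨C, hC, hCsub⟩ := (isCirculation_slack q c hm hn).exists_isEdgeCycle h
      (tightFace_ne_iff.mp hproper)
    have hs := (hC.isCirculation 1).slack_slackCoeff hm hn
    have hsupp : Function.support (C.indicator fun _ => (1 : ℝ)) = C :=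
      by
      rw [Set.support_indicator, Function.support_const one_ne_zero, Set.inter_univ]
    have hnn : (0 : Finset (Fin m ⊕ Fin n) → ℝ) ≤ C.indicator fun _ => (1 : ℝ) :=
      fun S => Set.indicator_nonneg (fun _ _ => zero_le_one) S
    have hne : (C.indicator fun _ => (1 : ℝ)) ≠ 0 := by
      rw [← Function.support_nonempty_iff, hsupp]
      exact hC.nonempty
    rw [← hs] at hsupp hnn hne
    have hle := hmax ⟨isExposed_tightFace hnn, tightFace_ne_iff.mpr hne⟩
      (tightFace_subset h hnn (by rwa [hsupp]))
    have hsub := coFacet_anti hle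
    rw [coFacet_tightFace, coFacet_tightFace, hsupp] at hsub
    rwa [hsub.antisymm hCsub]
  · intro hC
    refine ⟨⟨isExposed_tightFace h, tightFace_ne_iff.mpr ?_⟩, ?_⟩
    · exact Function.support_nonempty_iff.mp hC.nonempty
    · rintro G ⟨hG, hGP⟩ hle
      obtain ⟨q', c', h', rfl⟩ := exists_tightFace_eq hG
      have hsub := coFacet_anti hle
      rw [coFacet_tightFace, coFacet_tightFace] at hsub
      -- A larger proper face has slack supported in the cycle, hence a nonzero multiple of its
      -- indicator, so it contains no further vertices.
      obtain ⟨t, ht⟩ := (isCirculation_slack q' c' hm hn).eq_indicator hC hsub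
      have ht0 : t ≠ 0 := by
        rintro rfl
        exact tightFace_ne_iff.mp hGP (ht.trans (Set.indicator_zero _ _))
      refine tightFace_subset h' h ?_
      rw [ht, Set.support_indicator, Function.support_const ht0, Set.inter_univ]

theorem facetWidth_pos (m n : ℕ) : 0 < facetWidth m n := by
  unfold facetWidth
  positivity

/-- The normalized facet inequality of a cycle is the one whose slack is `2^{m+n-3}` on the
cycle and zero elsewhere. -/
theorem isNormalizedFacetInequality_iff (hm : 1 ≤ m) (hn : 1 ≤ n)
    {C : Set (Finset (Fin m ⊕ Fin n))} (hC : IsDirectedCycle m n C)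
    {q : NonemptyFace (dualComplex m n) → ℝ} {c : ℝ} :
    IsNormalizedFacetInequality m n C q c ↔
      slack (dualComplex m n) q c = C.indicator fun _ => facetWidth m n := by
  have hw := facetWidth_pos m n
  have hsupp : Function.support (C.indicator fun _ => facetWidth m n) = C := by
    rw [Set.support_indicator, Function.support_const hw.ne', Set.inter_univ]
  constructor
  · rintro ⟨⟨-, -, hco⟩, S, hS⟩
    change coFacet _ (tightFace _ q c) = C at hco
    rw [coFacet_tightFace] at hco
    obtain ⟨t, ht⟩ := (isCirculation_slack q c hm hn).eq_indicator
      (isDirectedCycle_iff.mp hC) hco.subset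
    have hS' : slack (dualComplex m n) q c S = facetWidth m n := by
      rw [slack, hS]
      ring
    have hSC : S ∈ C := hco ▸ (show S ∈ Function.support _ from hS'.trans_ne hw.ne')
    rw [ht, Set.indicator_of_mem hSC] at hS'
    rw [ht, hS']
  · intro hs
    have hnn : 0 ≤ slack (dualComplex m n) q c := by
      rw [hs]
      exact fun S => Set.indicator_nonneg (fun _ _ => hw.le) S
    have hco : coFacet _ (tightFace (dualComplex m n) q c) = C := by
      rw [coFacet_tightFace, hs, hsupp]
    refine ⟨⟨fun x hx => dotProduct_le_of_slack_nonneg hnn hx, ?_, hco⟩, ?_⟩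
    · refine (isFacet_tightFace_iff hm hn hnn).mpr ?_
      rwa [← coFacet_tightFace, hco]
    · obtain ⟨S, hS⟩ := (isDirectedCycle_iff.mp hC).nonempty
      have := congrFun hs S
      rw [Set.indicator_of_mem hS, slack] at this
      exact ⟨S, by linarith⟩

theorem isNormalizedFacetInequality_iff_eq (hm : 1 ≤ m) (hn : 1 ≤ n)
    {C : Set (Finset (Fin m ⊕ Fin n))} (hC : IsDirectedCycle m n C)
    {q : NonemptyFace (dualComplex m n) → ℝ} {c : ℝ} :
    IsNormalizedFacetInequality m n C q c ↔
      q = slackCoeff (dualComplex m n) (C.indicator fun _ => facetWidth m n) ∧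
        c = C.indicator (fun _ => facetWidth m n) ∅ := by
  rw [isNormalizedFacetInequality_iff hm hn hC]
  constructor
  · intro h
    rw [← h, slackCoeff_slack, slack_empty]
    exact ⟨rfl, rfl⟩
  · rintro ⟨rfl, rfl⟩
    exact ((isDirectedCycle_iff.mp hC).isCirculation _).slack_slackCoeff hm hn

theorem bijOn_coFacet (hm : 1 ≤ m) (hn : 1 ≤ n) :
    Set.BijOn (coFacet (dualComplex m n))
      {F | IsFacet (GCut (dualComplex m n)) F} {C | IsDirectedCycle m n C} := by
  refine ⟨fun F hF => ?_, fun F hF G hG hFG => ?_, fun C hC => ?_⟩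
  · change IsFacet _ _ at hF
    obtain ⟨q, c, h, rfl⟩ := exists_tightFace_eq hF.prop.1
    rw [coFacet_tightFace]
    exact (isFacet_tightFace_iff hm hn h).mp hF
  · change IsFacet _ _ at hF
    obtain ⟨q, c, h, rfl⟩ := exists_tightFace_eq hF.prop.1
    change IsFacet _ _ at hG
    obtain ⟨q', c', h', rfl⟩ := exists_tightFace_eq hG.prop.1
    rw [coFacet_tightFace, coFacet_tightFace] at hFG
    exact (tightFace_subset h h' hFG.superset).antisymm (tightFace_subset h' h hFG.subset)
  · obtain ⟨-, hfacet, hco⟩ :=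
      ((isNormalizedFacetInequality_iff_eq hm hn hC).mpr ⟨rfl, rfl⟩).1
    exact ⟨_, hfacet, hco⟩

end Facet

/-! ### Gluing -/

section Glue

variable {m n : ℕ} {C₁ C₂ : Set (Finset (Fin m ⊕ Fin n))} {A₁ A₂ : Finset (Fin m)}
  {B₁ B₂ : Finset (Fin n)}

theorem glue_eq (hdisj : NodeDisjoint C₁ C₂) (h₁ : A₁.disjSum B₁ ∈ C₁)
    (h₂ : A₂.disjSum B₂ ∈ C₂) :
    glue C₁ C₂ A₁ A₂ B₁ B₂ = insert (A₁.disjSum B₂) (C₁ \ {A₁.disjSum B₁}) ∪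
      insert (A₂.disjSum B₁) (C₂ \ {A₂.disjSum B₂}) := by
  have hA : A₁ ≠ A₂ := by simpa using (hdisj _ h₁ _ h₂).1
  have hB : B₁ ≠ B₂ := by simpa using (hdisj _ h₁ _ h₂).2
  have hne : ∀ S ∈ C₁, S ≠ A₂.disjSum B₂ := by
    rintro _ hS rfl
    simpa using hdisj _ hS _ h₂
  have hne' : ∀ S ∈ C₂, S ≠ A₁.disjSum B₁ := by
    rintro _ hS rfl
    simpa using hdisj _ h₁ _ hS
  have hinj : ∀ A A' : Finset (Fin m), ∀ B B' : Finset (Fin n),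
      A.disjSum B = A'.disjSum B' ↔ A = A' ∧ B = B' := by
    intro A A' B B'
    simp [Finset.disjSum_eq_iff]
  ext S
  simp only [glue, Set.mem_sdiff, Set.mem_union, Set.mem_insert_iff, Set.mem_singleton_iff]
  constructor
  · tauto
  · rintro ((rfl | h) | (rfl | h))
    · simp [hinj, hA, hB.symm]
    · exact ⟨Or.inl (Or.inl h.1), not_or.mpr ⟨h.2, hne S h.1⟩⟩
    · simp [hinj, hA.symm, hB]
    · exact ⟨Or.inl (Or.inr h.1), not_or.mpr ⟨hne' S h.1, h.2⟩⟩

theorem isDirectedCycle_glue (hC₁ : IsDirectedCycle m n C₁) (hC₂ : IsDirectedCycle m n C₂)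
    (hdisj : NodeDisjoint C₁ C₂) (h₁ : A₁.disjSum B₁ ∈ C₁) (h₂ : A₂.disjSum B₂ ∈ C₂)
    (hAB : A₁.card ≡ B₁.card [MOD 2]) (hA : A₁.card ≡ A₂.card [MOD 2])
    (hAB' : A₁.card ≡ B₂.card [MOD 2]) : IsDirectedCycle m n (glue C₁ C₂ A₁ A₂ B₁ B₂) := by
  have hev : ∀ {a b : ℕ}, a ≡ b [MOD 2] → Even (a + b) := by
    intro a b h
    have : a % 2 = b % 2 := h
    rw [Nat.even_iff]
    omega
  have e11 := hev hAB
  have e12 := hev hAB'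
  have e21 := hev (hA.symm.trans hAB)
  have e22 := hev (hA.symm.trans hAB')
  rw [isDirectedCycle_iff] at *
  rw [glue_eq hdisj h₁ h₂]
  refine hC₁.join hC₂ (fun x hx y hy h => ?_) h₁ h₂ ?_ ?_ ?_ ?_
  · unfold edgeSrc at h
    have := hdisj x hx y hy
    split_ifs at h <;> simp_all
  -- All four edges between the `A_i` and the `B_j` are even and run from `A_i` to `B_j`, so
  -- crossing over keeps sources and swaps targets.
  all_goals simp [edgeSrc, edgeTgt, e11, e12, e21, e22]

/-- Node-disjointness keeps the two new edges out of both cycles and each removed edge out of the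
other cycle, so every correction has multiplicity one. -/
theorem indicator_glue (hdisj : NodeDisjoint C₁ C₂) (h₁ : A₁.disjSum B₁ ∈ C₁)
    (h₂ : A₂.disjSum B₂ ∈ C₂) (t : ℝ) :
    (glue C₁ C₂ A₁ A₂ B₁ B₂).indicator (fun _ => t) =
      C₁.indicator (fun _ => t) + C₂.indicator (fun _ => t) +
        (Pi.single (A₁.disjSum B₂) t + Pi.single (A₂.disjSum B₁) t -
          Pi.single (A₁.disjSum B₁) t - Pi.single (A₂.disjSum B₂) t) := by
  classical
  have hA : A₁ ≠ A₂ := by simpa using (hdisj _ h₁ _ h₂).1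
  have hB : B₁ ≠ B₂ := by simpa using (hdisj _ h₁ _ h₂).2
  have hinj : ∀ A A' : Finset (Fin m), ∀ B B' : Finset (Fin n),
      A.disjSum B = A'.disjSum B' ↔ A = A' ∧ B = B' := by
    intro A A' B B'
    simp [Finset.disjSum_eq_iff]
  have h₁₂ : A₁.disjSum B₁ ∉ C₂ := fun h => by simpa using hdisj _ h₁ _ h
  have h₂₁ : A₂.disjSum B₂ ∉ C₁ := fun h => by simpa using hdisj _ h _ h₂
  have ha₁ : A₁.disjSum B₂ ∉ C₁ := fun h => by simpa using hdisj _ h _ h₂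
  have ha₂ : A₁.disjSum B₂ ∉ C₂ := fun h => by simpa using hdisj _ h₁ _ h
  have hb₁ : A₂.disjSum B₁ ∉ C₁ := fun h => by simpa using hdisj _ h _ h₂
  have hb₂ : A₂.disjSum B₁ ∉ C₂ := fun h => by simpa using hdisj _ h₁ _ h
  funext S
  simp only [Pi.add_apply, Pi.sub_apply, Pi.single_apply, Set.indicator_apply, glue,
    Set.mem_sdiff, Set.mem_union, Set.mem_insert_iff, Set.mem_singleton_iff]
  by_cases c11 : S = A₁.disjSum B₁
  · subst c11; simp [hinj, hA, hB, h₁, h₁₂]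
  by_cases c22 : S = A₂.disjSum B₂
  · subst c22; simp [hinj, hA.symm, hB.symm, h₂, h₂₁]
  by_cases c12 : S = A₁.disjSum B₂
  · subst c12; simp [hinj, hA, hB.symm, ha₁, ha₂]
  by_cases c21 : S = A₂.disjSum B₁
  · subst c21; simp [hinj, hA.symm, hB, hb₁, hb₂]
  have hnot : ¬ (S ∈ C₁ ∧ S ∈ C₂) := fun h => (hdisj _ h.1 _ h.2).1 rfl
  by_cases hS₁ : S ∈ C₁ <;> by_cases hS₂ : S ∈ C₂ <;> simp_all

theorem slackCoeff_add {V : Type*} [DecidableEq V] [Fintype V] (Δ : LowerSet (Finset V))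
    (f g : Finset V → ℝ) : slackCoeff Δ (f + g) = slackCoeff Δ f + slackCoeff Δ g := by
  funext F
  simp only [slackCoeff, setFourier, Pi.add_apply, add_mul, Finset.sum_add_distrib]
  ring

/-- The functional `a` belongs to the change of the slack at the four edges of the gluing. -/
theorem slackCoeff_cross (m n : ℕ) (A₁ A₂ : Finset (Fin m)) (B₁ B₂ : Finset (Fin n)) :
    slackCoeff (dualComplex m n) (Pi.single (A₁.disjSum B₂) (facetWidth m n) +
      Pi.single (A₂.disjSum B₁) (facetWidth m n) - Pi.single (A₁.disjSum B₁) (facetWidth m n) -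
        Pi.single (A₂.disjSum B₂) (facetWidth m n)) = gluingFunctional A₁ A₂ B₁ B₂ := by
  have hw : facetWidth m n = 2 ^ (m + n) / 8 := by
    rw [facetWidth, zpow_sub₀ two_ne_zero, ← Nat.cast_add, zpow_natCast]
    norm_num
  have h2 : (2 : ℝ) ^ (m + n) ≠ 0 := by positivity
  funext F
  simp only [slackCoeff, setFourier, Pi.add_apply, Pi.sub_apply, add_mul, sub_mul,
    Finset.sum_add_distrib, Finset.sum_sub_distrib, Pi.single_apply, ite_mul, zero_mul,
    Finset.sum_ite_eq', Finset.mem_univ, if_true, setCharacter_eq_mul, Finset.toLeft_disjSum,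
    Finset.toRight_disjSum, Fintype.card_sum, Fintype.card_fin, hw]
  -- With `α_i`, `β_i` the characters at `A_i`, `B_i`, the coefficient is `(α₁ - α₂)(β₂ - β₁) / 4`,
  -- which is `0` or `±1`. The normalization `2^{m+n-3}` produces the `1/4`.
  simp only [setCharacter_eq_ite, gluingFunctional, ← Nat.not_odd_iff_even]
  by_cases a1 : Odd (F.1.toLeft ∩ A₁).card <;> by_cases a2 : Odd (F.1.toLeft ∩ A₂).card <;>
  by_cases b1 : Odd (F.1.toRight ∩ B₁).card <;> by_cases b2 : Odd (F.1.toRight ∩ B₂).card <;>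
  simp only [a1, a2, b1, b2, if_true, if_false, not_true, not_false_eq_true, and_true,
    and_false, and_self] <;> field_simp <;> norm_num

end Glue

theorem theorem6p4 (m n : ℕ) (hm : 1 ≤ m) (hn : 1 ≤ n) :
    -- taking co-facets is a bijection from the facets to the directed cycles
    Set.BijOn (coFacet (dualComplex m n))
      {F | IsFacet (GCut (dualComplex m n)) F} {C | IsDirectedCycle m n C} ∧
    -- every directed cycle has exactly one normalized facet-defining inequality
    (∀ C, IsDirectedCycle m n C →
      ∃! p : (NonemptyFace (dualComplex m n) → ℝ) × ℝ,
        IsNormalizedFacetInequality m n C p.1 p.2) ∧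
    -- its right-hand side and its values on the vertices
    (∀ C q c, IsDirectedCycle m n C → IsNormalizedFacetInequality m n C q c →
      (c = 0 ∨ c = facetWidth m n) ∧
      ∀ S, q ⬝ᵥ cutVector (dualComplex m n) S = c ∨
        q ⬝ᵥ cutVector (dualComplex m n) S = c - facetWidth m n) ∧
    -- the inequality of a cycle that is glued from two cycles
    (∀ (C₁ C₂ : Set (Finset (Fin m ⊕ Fin n))) (A₁ A₂ : Finset (Fin m)) (B₁ B₂ : Finset (Fin n))
        (q₁ q₂ : NonemptyFace (dualComplex m n) → ℝ) (c₁ : ℝ),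
      IsDirectedCycle m n C₁ → IsDirectedCycle m n C₂ → NodeDisjoint C₁ C₂ →
      A₁.disjSum B₁ ∈ C₁ → A₂.disjSum B₂ ∈ C₂ →
      A₁.card ≡ B₁.card [MOD 2] → A₁.card ≡ A₂.card [MOD 2] → A₁.card ≡ B₂.card [MOD 2] →
      ((A₁ ≠ ∅ ∧ A₂ ≠ ∅) ∨ (B₁ ≠ ∅ ∧ B₂ ≠ ∅)) →
      IsNormalizedFacetInequality m n C₁ q₁ c₁ →
      IsNormalizedFacetInequality m n C₂ q₂ 0 →
      IsDirectedCycle m n (glue C₁ C₂ A₁ A₂ B₁ B₂) ∧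
      IsNormalizedFacetInequality m n (glue C₁ C₂ A₁ A₂ B₁ B₂)
        (q₁ + q₂ + gluingFunctional A₁ A₂ B₁ B₂) c₁) := by
  refine ⟨bijOn_coFacet hm hn, ?_, ?_, ?_⟩
  · intro C hC
    refine ⟨(_, _), (isNormalizedFacetInequality_iff_eq hm hn hC).mpr ⟨rfl, rfl⟩, ?_⟩
    rintro ⟨q, c⟩ h
    obtain ⟨h1, h2⟩ := (isNormalizedFacetInequality_iff_eq hm hn hC).mp h
    exact Prod.ext h1 h2
  · intro C q c hC h
    rw [isNormalizedFacetInequality_iff hm hn hC] at h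
    have hcases : ∀ S, slack (dualComplex m n) q c S = 0 ∨
        slack (dualComplex m n) q c S = facetWidth m n := by
      intro S
      rw [h]
      exact Set.indicator_eq_zero_or_self C _ S
    constructor
    · simpa only [slack_empty] using hcases ∅
    · intro S
      refine (hcases S).imp (fun hS => ?_) fun hS => ?_ <;> rw [slack] at hS <;> linarith
  · intro C₁ C₂ A₁ A₂ B₁ B₂ q₁ q₂ c₁ hC₁ hC₂ hdisj h₁ h₂ hAB hA hAB' hne hq₁ hq₂
    have hC := isDirectedCycle_glue hC₁ hC₂ hdisj h₁ h₂ hAB hA hAB'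
    refine ⟨hC, (isNormalizedFacetInequality_iff_eq hm hn hC).mpr ?_⟩
    obtain ⟨rfl, rfl⟩ := (isNormalizedFacetInequality_iff_eq hm hn hC₁).mp hq₁
    obtain ⟨rfl, h0⟩ := (isNormalizedFacetInequality_iff_eq hm hn hC₂).mp hq₂
    rw [indicator_glue hdisj h₁ h₂, slackCoeff_add, slackCoeff_add, slackCoeff_cross]
    refine ⟨rfl, ?_⟩
    -- The right-hand side is the slack at `∅`. None of the four altered edges is `∅`, and `C₂`
    -- contributes `0` there, so `c₁` remains.
    have hempty : ∀ (A : Finset (Fin m)) (B : Finset (Fin n)), A ≠ ∅ ∨ B ≠ ∅ →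
        (∅ : Finset (Fin m ⊕ Fin n)) ≠ A.disjSum B := by
      intro A B hAB h
      rw [Finset.eq_disjSum_iff] at h
      rcases hAB with hA | hB
      · exact hA (h.1.symm.trans (by ext; simp))
      · exact hB (h.2.symm.trans (by ext; simp))
    have e11 := hempty A₁ B₁ (hne.imp And.left And.left)
    have e12 := hempty A₁ B₂ (hne.imp And.left And.right)
    have e21 := hempty A₂ B₁ (hne.imp And.right And.left)
    have e22 := hempty A₂ B₂ (hne.imp And.right And.right)
    simp only [Pi.add_apply, Pi.sub_apply, Pi.single_eq_of_ne e11, Pi.single_eq_of_ne e12,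
      Pi.single_eq_of_ne e21, Pi.single_eq_of_ne e22, ← h0]
    ring
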